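/- Let $k$ be a commutative artinian ring, let $n\ge 1$ be an integer, and let $(\mathscr C,\mathbb E,\mathfrak s)$ be an $n$-exangulated category (in the sense of Herschend–Liu–Nakaoka) which is $k$-linear, Krull–Schmidt, and $\mathrm{Ext}$-finite, i.e. every $\mathbb E(A,B)$ is a finitely generated $k$-module. Inflations and deflations are the first and the last morphisms of conflations, and for a morphism $a$ with source $A$ and an extension $\delta\in\mathbb E(Y,A)$ we write $a_*\delta=\mathbb E(Y,a)(\delta)$. Assume that for all composable morphisms $f,g$: if $g\circ f$ is a deflation, then so is $g$; if $g\circ f$ is an inflation, then so is $f$. Let $\underline{\mathscr C}$ (resp. $\overline{\mathscr C}$) be the stable (resp. costable) category: the quotient of $\mathscr C$ by the morphisms $f$ with $\mathbb E(f,Z)=0$ (resp. $\mathbb E(Z,f)=0$) for all objects $Z$. Let $D=\mathrm{Hom}_k(-,I)$, where $I$ is the minimal injective cogenerator of $k$. Assume that $\mathscr C$ has Auslander–Reiten–Serre duality, i.e. that there are a $k$-linear equivalence $\tau_n:\underline{\mathscr C}\to\overline{\mathscr C}$ and $k$-linear isomorphisms $D\mathbb E(X,Y)\cong\overline{\mathscr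 C}(Y,\tau_nX)$, natural in $X$ and $Y$; let $\tau_n^-$ be a quasi-inverse of $\tau_n$. For objects $T,Y$, a morphism $f:W\to Y$ is right $T$-determined if every $g:L\to Y$, such that $g\circ h$ factors through $f$ for all $h:T\to L$, factors through $f$. Morphisms $f,f'$ to $Y$ are right equivalent if each factors through the other; $[f\rangle$ denotes the class of $f$, and classes are partially ordered by $[f\rangle\le[f'\rangle$ if and only if $f$ factors through $f'$. Let ${}^{T}[\to Y\rangle_{\mathrm{def}}$ be the poset of classes $[f\rangle$ of deflations $f$ to $Y$ that are right $T$-determined. For objects $X,Y$, let $\mathrm{sub}_{\mathrm{End}(X)}\mathbb E(Y,X)$ be the set, ordered by inclusion, of finitely generated $\mathrm{End}_{\mathscr C}(X)$-submodules of $\mathbb E(Y,X)$, where $g\in\mathrm{End}_{\mathscr C}(X)$ acts by $\delta\mapsto g_*\delta$. Theorem. For all objects $X,Y$ of $\mathscr C$ there is a well-defined map $$\xi_{X,Y}:{}^{\tau_n^-X}[\to Y\rangle_{\mathrm{def}}\longrightarrow \mathrm{sub}_{\mathrm{End}(X)}\mathbb E(Y,X),\qquad [f\rangle\longmapsto \mathrm{Im}\big((\delta_f^\sharp)_X\big)=\{a_*\delta_f\mid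 a\in\mathscr C(A,X)\},$$ where $A\to Z_1\to\cdots\to Z_{n-1}\to W\xrightarrow{f}Y\overset{\delta_f}{\dashrightarrow}$ is any distinguished $n$-exangle ending in a deflation $f$ that represents the class, and $\xi_{X,Y}$ is an anti-isomorphism of posets, i.e. a bijection such that $c\le c'$ if and only if $\xi_{X,Y}(c)\supseteq\xi_{X,Y}(c')$. -/

import Mathlib

open CategoryTheory CategoryTheory.Limits Opposite ZeroObject

universe u v w u₁

noncomputable section

namespace NExang

attribute [local instance] hasBinaryBiproducts_of_finite_biproducts

variable {k : Type u} [CommRing k] {C : Type u₁} [Category.{v} C]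

/-! ### Bifunctors of extensions -/

/-- The `k`-module `𝔼(B, A)` of extensions with right end `B` and left end `A`. -/
def Extension (E : Cᵒᵖ ⥤ C ⥤ ModuleCat.{w} k) (B A : C) : Type w := (E.obj (op B)).obj A

section

variable (E : Cᵒᵖ ⥤ C ⥤ ModuleCat.{w} k)

instance (B A : C) : AddCommGroup (Extension E B A) :=
  inferInstanceAs (AddCommGroup ((E.obj (op B)).obj A))

instance (B A : C) : Module k (Extension E B A) :=
  inferInstanceAs (Module k ((E.obj (op B)).obj A))

/-- `δ ↦ c^* δ`, the map `𝔼(c, A) : 𝔼(B, A) → 𝔼(B', A)`. -/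
def pull {B' B A : C} (c : B' ⟶ B) : Extension E B A →ₗ[k] Extension E B' A :=
  ((E.map c.op).app A).hom

/-- `δ ↦ a_* δ`, the map `𝔼(B, a) : 𝔼(B, A) → 𝔼(B, A')`. -/
def push {B A A' : C} (a : A ⟶ A') : Extension E B A →ₗ[k] Extension E B A' :=
  ((E.obj (op B)).map a).hom

@[simp] lemma pull_id (B A : C) (δ : Extension E B A) : pull E (𝟙 B) δ = δ := by
  simp [pull]; rfl

@[simp] lemma push_id (B A : C) (δ : Extension E B A) : push E (𝟙 A) δ = δ := by
  simp [push]; rfl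

lemma pull_comp {B'' B' B A : C} (c : B'' ⟶ B') (c' : B' ⟶ B) (δ : Extension E B A) :
    pull E (c ≫ c') δ = pull E c (pull E c' δ) := by
  simp only [pull, op_comp, Functor.map_comp, NatTrans.comp_app, ModuleCat.hom_comp]; rfl

lemma push_comp {B A A' A'' : C} (a : A ⟶ A') (a' : A' ⟶ A'') (δ : Extension E B A) :
    push E (a ≫ a') δ = push E a' (push E a δ) := by
  simp only [push, Functor.map_comp, ModuleCat.hom_comp]; rfl

lemma push_pull {B' B A A' : C} (c : B' ⟶ B) (a : A ⟶ A') (δ : Extension E B A) :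
    push E a (pull E c δ) = pull E c (push E a δ) := by
  have h := (E.map c.op).naturality a
  exact (congrArg (fun t => t.hom δ) h).symm

variable [Preadditive C] [Linear k C]

/-- `𝔼` is `k`-linear (in particular additive) in both variables. -/
class IsBilinear : Prop where
  pull_add : ∀ {B' B : C} (A : C) (c c' : B' ⟶ B),
    (pull E (c + c') : Extension E B A →ₗ[k] _) = pull E c + pull E c'
  pull_smul : ∀ {B' B : C} (A : C) (r : k) (c : B' ⟶ B),
    (pull E (r • c) : Extension E B A →ₗ[k] _) = r • pull E c
  push_add : ∀ {A A' : C} (B : C) (a a' : A ⟶ A'),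
    (push E (a + a') : Extension E B A →ₗ[k] _) = push E a + push E a'
  push_smul : ∀ {A A' : C} (B : C) (r : k) (a : A ⟶ A'),
    (push E (r • a) : Extension E B A →ₗ[k] _) = r • push E a

end

variable [Preadditive C] [Linear k C]

/-! ### Complexes concentrated in degrees `0, …, n + 1` with prescribed ends -/

variable (C) in
/-- A complex `X₀ ⟶ X₁ ⟶ ⋯ ⟶ X_{n+1}` (zero in all other degrees) whose end terms are identified
with `A` and `B`. -/
structure EndedComplex (n : ℕ) (A B : C) where
  K : CochainComplex C ℕ
  isZero : ∀ i, n + 1 < i → IsZero (K.X i)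
  left : K.X 0 ≅ A
  right : K.X (n + 1) ≅ B

namespace EndedComplex

variable {n : ℕ} {A B A' B' : C}

/-- The first differential `A ⟶ X₁`. -/
def dFirst (X : EndedComplex C n A B) : A ⟶ X.K.X 1 := X.left.inv ≫ X.K.d 0 1

/-- The last differential `X_n ⟶ B`. -/
def dLast (X : EndedComplex C n A B) : X.K.X n ⟶ B := X.K.d n (n + 1) ≫ X.right.hom

/-- The chain map `f` is `a` in degree `0` and `c` in degree `n + 1`. -/
def IsLift (X : EndedComplex C n A B) (Y : EndedComplex C n A' B') (f : X.K ⟶ Y.K)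
    (a : A ⟶ A') (c : B ⟶ B') : Prop :=
  f.f 0 ≫ Y.left.hom = X.left.hom ≫ a ∧
    f.f (n + 1) ≫ Y.right.hom = X.right.hom ≫ c

/-- Homotopy equivalence of complexes from `A` to `B`, by chain maps which are the identity on
both ends. -/
def HomotopyEquivalent (X Y : EndedComplex C n A B) : Prop :=
  ∃ e : HomotopyEquiv X.K Y.K, IsLift X Y e.hom (𝟙 A) (𝟙 B) ∧ IsLift Y X e.inv (𝟙 A) (𝟙 B)

lemma HomotopyEquivalent.equivalence :
    Equivalence (HomotopyEquivalent (C := C) (n := n) (A := A) (B := B)) where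
  refl X := ⟨HomotopyEquiv.refl _, by simp [IsLift, HomotopyEquiv.refl]⟩
  symm := fun ⟨e, h₁, h₂⟩ => ⟨e.symm, h₂, h₁⟩
  trans := by
    rintro X Y Z ⟨e, h₁, h₂⟩ ⟨e', h₁', h₂'⟩
    refine ⟨e.trans e', ?_, ?_⟩ <;>
      simp_all [IsLift, HomotopyEquiv.trans]

variable (C n A B) in
instance setoid : Setoid (EndedComplex C n A B) := ⟨_, HomotopyEquivalent.equivalence⟩

variable [HasFiniteBiproducts C]

/-- The complex `A = A ⟶ 0 ⟶ ⋯ ⟶ 0` from `A` to `0`. -/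
def trivialLeft (n : ℕ) [NeZero n] (A : C) : EndedComplex C n A 0 where
  K := HomologicalComplex.double (𝟙 A) (show (ComplexShape.up ℕ).Rel 0 1 from rfl)
  isZero i hi := HomologicalComplex.isZero_double_X _ _ _ (by omega) (by omega)
  left := HomologicalComplex.doubleXIso₀ _ _
  right := (HomologicalComplex.isZero_double_X _ _ _ (by omega)
    (by have := NeZero.ne n; omega)).iso (isZero_zero C)

/-- The complex `0 ⟶ ⋯ ⟶ 0 ⟶ A = A` from `0` to `A`. -/
def trivialRight (n : ℕ) [NeZero n] (A : C) : EndedComplex C n 0 A where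
  K := HomologicalComplex.double (𝟙 A) (show (ComplexShape.up ℕ).Rel n (n + 1) from rfl)
  isZero i hi := HomologicalComplex.isZero_double_X _ _ _ (by omega) (by omega)
  left := (HomologicalComplex.isZero_double_X _ _ _ (NeZero.ne n).symm (by omega)).iso
    (isZero_zero C)
  right := HomologicalComplex.doubleXIso₁ _ _ (by omega)

/-- The data exhibiting `M` as the mapping cone
`X₁ ⟶ X₂ ⊕ Y₁ ⟶ ⋯ ⟶ X_{n+1} ⊕ Y_n ⟶ B'`
of a chain map `f` which is the identity on the left end, with differentials
`[-d ; f]`, `[[-d, 0], [f, d]]`, `[f, d]`.  The interior terms are identified with the displayed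
biproducts by isomorphisms, which does not affect the homotopy class of `M`. -/
structure MappingCone {X : EndedComplex C n A B} {Y : EndedComplex C n A B'}
    (f : X.K ⟶ Y.K) (M : EndedComplex C n (X.K.X 1) B') where
  iso : ∀ i, 1 ≤ i → i ≤ n → (M.K.X i ≅ X.K.X (i + 1) ⊞ Y.K.X i)
  d_first : ∀ h : 1 ≤ n, M.dFirst ≫ (iso 1 le_rfl h).hom =
    biprod.lift (-X.K.d 1 2) (f.f 1)
  d_mid : ∀ i (h₁ : 1 ≤ i) (h₂ : i + 1 ≤ n),
    M.K.d i (i + 1) ≫ (iso (i + 1) (by omega) h₂).hom =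
      (iso i h₁ (by omega)).hom ≫ biprod.lift (biprod.fst ≫ (-X.K.d (i + 1) (i + 2)))
        (biprod.fst ≫ f.f (i + 1) + biprod.snd ≫ Y.K.d i (i + 1))
  d_last : ∀ h : 1 ≤ n, M.dLast =
    (iso n h le_rfl).hom ≫ biprod.desc (f.f (n + 1) ≫ Y.right.hom) Y.dLast

/-- The data exhibiting `N` as the mapping cocone
`A ⟶ X₁ ⊕ Y₀ ⟶ X₂ ⊕ Y₁ ⟶ ⋯ ⟶ X_n ⊕ Y_{n-1} ⟶ Y_n`
of a chain map `f` which is the identity on the right end, with differentials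
`[d ; f]`, `[[d, 0], [f, -d]]`, `[f, -d]` (the dual of the mapping cone). -/
structure MappingCocone {X : EndedComplex C n A B} {Y : EndedComplex C n A' B}
    (f : X.K ⟶ Y.K) (N : EndedComplex C n A (Y.K.X n)) where
  iso : ∀ i j, i + 1 = j → j ≤ n → (N.K.X j ≅ X.K.X j ⊞ Y.K.X i)
  d_first : ∀ h : 1 ≤ n, N.dFirst ≫ (iso 0 1 rfl h).hom =
    biprod.lift X.dFirst (X.left.inv ≫ f.f 0)
  d_mid : ∀ i j l (hij : i + 1 = j) (hjl : j + 1 = l) (hl : l ≤ n),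
    N.K.d j l ≫ (iso j l hjl hl).hom =
      (iso i j hij (by omega)).hom ≫ biprod.lift (biprod.fst ≫ X.K.d j l)
        (biprod.fst ≫ f.f j - biprod.snd ≫ Y.K.d i j)
  d_last : ∀ i (h : i + 1 = n), N.dLast =
    (iso i n h le_rfl).hom ≫ biprod.desc (f.f n) (-Y.K.d i n)

end EndedComplex

/-! ### `n`-exangulated categories -/

section

variable (E : Cᵒᵖ ⥤ C ⥤ ModuleCat.{w} k) {n : ℕ}

/-- `⟨X, δ⟩` is an `n`-exangle: an attached complex for which the sequences
`𝒞(-, X₀) ⟶ ⋯ ⟶ 𝒞(-, X_{n+1}) ⟶ 𝔼(-, X₀)` and `𝒞(X_{n+1}, -) ⟶ ⋯ ⟶ 𝒞(X₀, -) ⟶ 𝔼(X_{n+1}, -)`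
are exact. -/
structure IsNExangle {A B : C} (X : EndedComplex C n A B) (δ : Extension E B A) : Prop where
  push_eq_zero : push E X.dFirst δ = 0
  pull_eq_zero : pull E X.dLast δ = 0
  contra_mid : ∀ (T : C) (i : ℕ), i < n →
    Function.Exact (fun g : T ⟶ X.K.X i => g ≫ X.K.d i (i + 1))
      (fun g : T ⟶ X.K.X (i + 1) => g ≫ X.K.d (i + 1) (i + 2))
  contra_last : ∀ T : C,
    Function.Exact (fun g : T ⟶ X.K.X n => g ≫ X.dLast) (fun g : T ⟶ B => pull E g δ)
  co_mid : ∀ (T : C) (i : ℕ), i < n →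
    Function.Exact (fun g : X.K.X (i + 2) ⟶ T => X.K.d (i + 1) (i + 2) ≫ g)
      (fun g : X.K.X (i + 1) ⟶ T => X.K.d i (i + 1) ≫ g)
  co_first : ∀ T : C,
    Function.Exact (fun g : X.K.X 1 ⟶ T => X.dFirst ≫ g) (fun g : A ⟶ T => push E g δ)

variable (n) in
/-- A correspondence sending each extension `δ ∈ 𝔼(B, A)` to a homotopy equivalence class of
complexes from `A` to `B`. -/
def Correspondence : Type _ :=
  ∀ ⦃A B : C⦄, Extension E B A → _root_.Quotient (EndedComplex.setoid C n A B)

variable {E}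

/-- `X` realizes `δ`, i.e. `𝔰(δ) = [X]`. -/
def Correspondence.Realizes (s : Correspondence E n) {A B : C} (X : EndedComplex C n A B)
    (δ : Extension E B A) : Prop :=
  s δ = Quotient.mk (EndedComplex.setoid C n A B) X

/-- `f` is an inflation: the first map of a conflation. -/
def Correspondence.IsInflation (s : Correspondence E n) {A W : C} (f : A ⟶ W) : Prop :=
  ∃ (B : C) (δ : Extension E B A) (X : EndedComplex C n A B) (e : X.K.X 1 ≅ W),
    s.Realizes X δ ∧ X.dFirst ≫ e.hom = f

/-- `⟨X, δ⟩` is a distinguished `n`-exangle whose last map is `f` (its term `X_n` being identified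
with `W` by means of `e`). -/
def Correspondence.IsExangleOf (s : Correspondence E n) {A B W : C} (f : W ⟶ B)
    (X : EndedComplex C n A B) (e : X.K.X n ≅ W) (δ : Extension E B A) : Prop :=
  s.Realizes X δ ∧ e.inv ≫ X.dLast = f

/-- `f` is a deflation: the last map of a conflation. -/
def Correspondence.IsDeflation (s : Correspondence E n) {W B : C} (f : W ⟶ B) : Prop :=
  ∃ (A : C) (δ : Extension E B A) (X : EndedComplex C n A B) (e : X.K.X n ≅ W),
    s.IsExangleOf f X e δ

/-- `𝔰` is an exact realization of `𝔼`. -/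
structure Correspondence.IsExactRealization [HasFiniteBiproducts C] [NeZero n]
    (s : Correspondence E n) : Prop where
  exists_lift : ∀ {A B A' B' : C} (δ : Extension E B A) (ρ : Extension E B' A')
    (X : EndedComplex C n A B) (Y : EndedComplex C n A' B') (a : A ⟶ A') (c : B ⟶ B'),
    s.Realizes X δ → s.Realizes Y ρ → push E a δ = pull E c ρ →
      ∃ f : X.K ⟶ Y.K, X.IsLift Y f a c
  isNExangle : ∀ {A B : C} (δ : Extension E B A) (X : EndedComplex C n A B),
    s.Realizes X δ → IsNExangle E X δ
  trivial_left : ∀ A : C, s.Realizes (EndedComplex.trivialLeft n A) 0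
  trivial_right : ∀ A : C, s.Realizes (EndedComplex.trivialRight n A) 0

variable (E) in
/-- `(𝒞, 𝔼, 𝔰)` is a `k`-linear `n`-exangulated category (`𝔼` being `k`-bilinear). The last two
conditions say that `(id, c)` and `(a, id)` have good lifts. -/
structure IsNExangulated [IsBilinear E] [HasFiniteBiproducts C] [NeZero n] (s : Correspondence E n) : Prop where
  isExactRealization : s.IsExactRealization
  inflation_comp : ∀ {A B D : C} (f : A ⟶ B) (g : B ⟶ D),
    s.IsInflation f → s.IsInflation g → s.IsInflation (f ≫ g)
  deflation_comp : ∀ {A B D : C} (f : A ⟶ B) (g : B ⟶ D),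
    s.IsDeflation f → s.IsDeflation g → s.IsDeflation (f ≫ g)
  good_lift : ∀ {A B D : C} (ρ : Extension E D A) (c : B ⟶ D)
    (X : EndedComplex C n A B) (Y : EndedComplex C n A D),
    s.Realizes X (pull E c ρ) → s.Realizes Y ρ →
      ∃ f : X.K ⟶ Y.K, X.IsLift Y f (𝟙 A) c ∧
        ∃ M : EndedComplex C n (X.K.X 1) D,
          Nonempty (EndedComplex.MappingCone f M) ∧ s.Realizes M (push E X.dFirst ρ)
  good_lift_op : ∀ {A A' B : C} (ρ : Extension E B A) (a : A ⟶ A')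
    (X : EndedComplex C n A B) (Y : EndedComplex C n A' B),
    s.Realizes X ρ → s.Realizes Y (push E a ρ) →
      ∃ f : X.K ⟶ Y.K, X.IsLift Y f a (𝟙 B) ∧
        ∃ N : EndedComplex C n A (Y.K.X n),
          Nonempty (EndedComplex.MappingCocone f N) ∧ s.Realizes N (pull E Y.dLast ρ)

/-- The weak idempotent completeness condition: if `f ≫ g` is a deflation then so is `g`, and if
`f ≫ g` is an inflation then so is `f`. -/
structure Correspondence.WIC (s : Correspondence E n) : Prop where
  deflation : ∀ {A B D : C} (f : A ⟶ B) (g : B ⟶ D), s.IsDeflation (f ≫ g) → s.IsDeflation g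
  inflation : ∀ {A B D : C} (f : A ⟶ B) (g : B ⟶ D), s.IsInflation (f ≫ g) → s.IsInflation f

end

/-- `𝒞` is Krull-Schmidt: every object is a finite direct sum of objects with local endomorphism
rings. -/
def IsKrullSchmidt (C : Type u₁) [Category.{v} C] [Preadditive C] [HasFiniteBiproducts C] : Prop :=
  ∀ X : C, ∃ (m : ℕ) (Y : Fin m → C),
    (∀ i, IsLocalRing (End (Y i))) ∧ Nonempty (X ≅ ⨁ Y)

/-- `𝔼(A, B)` is a finitely generated `k`-module for all `A`, `B`. -/
def IsExtFinite (E : Cᵒᵖ ⥤ C ⥤ ModuleCat.{w} k) : Prop :=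
  ∀ A B : C, Module.Finite k (Extension E A B)

/-! ### The stable and costable categories -/

section

variable (E : Cᵒᵖ ⥤ C ⥤ ModuleCat.{w} k)

/-- `f` is `n`-projectively trivial. -/
def IsProjTrivial {X Y : C} (f : X ⟶ Y) : Prop :=
  ∀ Z : C, (pull E f : Extension E Y Z →ₗ[k] Extension E X Z) = 0

/-- `g` is `n`-injectively trivial. -/
def IsInjTrivial {X Y : C} (g : X ⟶ Y) : Prop :=
  ∀ Z : C, (push E g : Extension E Z X →ₗ[k] Extension E Z Y) = 0

/-- Two morphisms are identified in the stable category when their difference is projectively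
trivial. -/
def stableRel : HomRel C := fun _ _ f g => IsProjTrivial E (f - g)

/-- Two morphisms are identified in the costable category when their difference is injectively
trivial. -/
def costableRel : HomRel C := fun _ _ f g => IsInjTrivial E (f - g)

variable [hE : IsBilinear E]

/-- `pull` as a `k`-linear map in the morphism. -/
def pullHom (B' B A : C) : (B' ⟶ B) →ₗ[k] (Extension E B A →ₗ[k] Extension E B' A) where
  toFun c := pull E c
  map_add' c c' := hE.pull_add A c c'
  map_smul' r c := hE.pull_smul A r c

/-- `push` as a `k`-linear map in the morphism. -/
def pushHom (B A A' : C) : (A ⟶ A') →ₗ[k] (Extension E B A →ₗ[k] Extension E B A') where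
  toFun a := push E a
  map_add' a a' := hE.push_add B a a'
  map_smul' r a := hE.push_smul B r a

lemma stableRel_iff {X Y : C} (f g : X ⟶ Y) :
    stableRel E f g ↔ ∀ Z, pullHom E X Y Z f = pullHom E X Y Z g := by
  refine forall_congr' fun Z => ?_
  rw [← sub_eq_zero (a := pullHom E X Y Z f), ← map_sub]; rfl

lemma costableRel_iff {X Y : C} (f g : X ⟶ Y) :
    costableRel E f g ↔ ∀ Z, pushHom E Z X Y f = pushHom E Z X Y g := by
  refine forall_congr' fun Z => ?_
  rw [← sub_eq_zero (a := pushHom E Z X Y f), ← map_sub]; rfl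

instance : Congruence (stableRel E) where
  equivalence :=
    { refl := fun f => by simp [stableRel_iff]
      symm := fun h => by
        rw [stableRel_iff] at *
        exact fun Z => (h Z).symm
      trans := fun h h' => by
        rw [stableRel_iff] at *
        exact fun Z => (h Z).trans (h' Z) }
  comp_left f g g' h := by
    rw [stableRel_iff] at *
    intro Z
    ext δ
    have := congrArg (fun t => t δ) (h Z)
    simp_all [pullHom, pull_comp]
  comp_right g h := by
    rw [stableRel_iff] at *
    intro Z
    ext δ
    have := congrArg (fun t => t (pull E g δ)) (h Z)
    simp_all [pullHom, pull_comp]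

instance : Congruence (costableRel E) where
  equivalence :=
    { refl := fun f => by simp [costableRel_iff]
      symm := fun h => by
        rw [costableRel_iff] at *
        exact fun Z => (h Z).symm
      trans := fun h h' => by
        rw [costableRel_iff] at *
        exact fun Z => (h Z).trans (h' Z) }
  comp_left f g g' h := by
    rw [costableRel_iff] at *
    intro Z
    ext δ
    have := congrArg (fun t => t (push E f δ)) (h Z)
    simp_all [pushHom, push_comp]
  comp_right g h := by
    rw [costableRel_iff] at *
    intro Z
    ext δ
    have := congrArg (fun t => t δ) (h Z)
    simp_all [pushHom, push_comp]

/-- The stable category: the objects of `𝒞`, with morphisms modulo projectively trivial ones. -/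
abbrev Stable : Type u₁ := CategoryTheory.Quotient (stableRel E)

/-- The costable category: the objects of `𝒞`, with morphisms modulo injectively trivial ones. -/
abbrev Costable : Type u₁ := CategoryTheory.Quotient (costableRel E)

/-- The canonical functor `𝒞 ⥤ 𝒞̲`. -/
abbrev toStable : C ⥤ Stable E := CategoryTheory.Quotient.functor (stableRel E)

/-- The canonical functor `𝒞 ⥤ 𝒞̅`. -/
abbrev toCostable : C ⥤ Costable E := CategoryTheory.Quotient.functor (costableRel E)

instance : Preadditive (Stable E) :=
  CategoryTheory.Quotient.preadditive _ fun X Y f₁ f₂ g₁ g₂ h h' => by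
    rw [stableRel_iff] at *
    intro Z
    rw [map_add, map_add, h, h']

instance : Preadditive (Costable E) :=
  CategoryTheory.Quotient.preadditive _ fun X Y f₁ f₂ g₁ g₂ h h' => by
    rw [costableRel_iff] at *
    intro Z
    rw [map_add, map_add, h, h']

instance : (toStable E).Additive := CategoryTheory.Quotient.functor_additive _ _

instance : (toCostable E).Additive := CategoryTheory.Quotient.functor_additive _ _

instance : Linear k (Stable E) :=
  CategoryTheory.Quotient.linear k _ fun a X Y f₁ f₂ h => by
    rw [stableRel_iff] at *
    intro Z
    rw [map_smul, map_smul, h]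

instance : Linear k (Costable E) :=
  CategoryTheory.Quotient.linear k _ fun a X Y f₁ f₂ h => by
    rw [costableRel_iff] at *
    intro Z
    rw [map_smul, map_smul, h]

end

/-! ### Auslander-Reiten-Serre duality -/

section

variable (k) (I : Type u) [AddCommGroup I] [Module k I]

/-- `I` is an injective `k`-module such that every nonzero element of a `k`-module is detected by a
linear map to `I`. -/
structure IsInjectiveCogenerator : Prop where
  injective : Module.Injective k I
  cogenerator : ∀ (M : Type u) [AddCommGroup M] [Module k M] (m : M), m ≠ 0 →
    ∃ φ : M →ₗ[k] I, φ m ≠ 0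

/-- `I` is an injective cogenerator, and no proper submodule of `I` is one. -/
structure IsMinimalInjectiveCogenerator : Prop extends IsInjectiveCogenerator k I where
  minimal : ∀ N : Submodule k I, IsInjectiveCogenerator k N → N = ⊤

end

/-- Auslander-Reiten-Serre duality, with respect to `D = Hom_k(-, I)`: a `k`-linear equivalence
`τ : 𝒞̲ ≌ 𝒞̅` together with `k`-linear isomorphisms `D 𝔼(X, Y) ≅ 𝒞̅(Y, τ X)` natural in both
variables. -/
structure ARSDuality (E : Cᵒᵖ ⥤ C ⥤ ModuleCat.{w} k) [IsBilinear E]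
    (I : Type u) [AddCommGroup I] [Module k I] where
  τ : Stable E ≌ Costable E
  additive : τ.functor.Additive
  linear : τ.functor.Linear k
  Φ : ∀ X Y : C, (Extension E X Y →ₗ[k] I) ≃ₗ[k]
    ((toCostable E).obj Y ⟶ τ.functor.obj ((toStable E).obj X))
  natural_right : ∀ (X : C) {Y Y' : C} (y : Y' ⟶ Y) (φ : Extension E X Y →ₗ[k] I),
    Φ X Y' (φ ∘ₗ push E y) = (toCostable E).map y ≫ Φ X Y φ
  natural_left : ∀ {X X' : C} (Y : C) (x : X ⟶ X') (φ : Extension E X Y →ₗ[k] I),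
    Φ X' Y (φ ∘ₗ pull E x) = Φ X Y φ ≫ τ.functor.map ((toStable E).map x)

/-- The object `τ⁻ X` of `𝒞`, where `τ⁻` is the quasi-inverse of `τ`. -/
def ARSDuality.tauInv {E : Cᵒᵖ ⥤ C ⥤ ModuleCat.{w} k} [IsBilinear E]
    {I : Type u} [AddCommGroup I] [Module k I] (T : ARSDuality E I) (X : C) : C :=
  (T.τ.inverse.obj ((toCostable E).obj X)).as

/-! ### Right equivalence classes and right determined morphisms -/

section

variable {D : Type u₁} [Category.{v} D]

/-- The morphisms to `Y`, preordered by `f₁ ≤ f₂` iff `f₁` factors through `f₂`. -/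
structure MorTo (Y : D) where
  src : D
  hom : src ⟶ Y

instance (Y : D) : Preorder (MorTo Y) where
  le f₁ f₂ := ∃ h : f₁.src ⟶ f₂.src, h ≫ f₂.hom = f₁.hom
  le_refl f := ⟨𝟙 _, Category.id_comp _⟩
  le_trans := by
    rintro f₁ f₂ f₃ ⟨h, hh⟩ ⟨h', hh'⟩
    exact ⟨h ≫ h', by rw [Category.assoc, hh', hh]⟩

/-- The poset `[→ Y⟩` of right equivalence classes of morphisms to `Y`. -/
abbrev RightClasses (Y : D) := Antisymmetrization (MorTo Y) (· ≤ ·)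

/-- The right equivalence class `[f⟩`. -/
def rightClass {X Y : D} (f : X ⟶ Y) : RightClasses Y :=
  toAntisymmetrization (· ≤ ·) (⟨X, f⟩ : MorTo Y)

/-- `f` is right `T`-determined. -/
def IsRightDetermined (T : D) {X Y : D} (f : X ⟶ Y) : Prop :=
  ∀ (L : D) (g : L ⟶ Y), (∀ h : T ⟶ L, ∃ t : T ⟶ X, t ≫ f = h ≫ g) → ∃ t : L ⟶ X, t ≫ f = g

end

section

variable {E : Cᵒᵖ ⥤ C ⥤ ModuleCat.{w} k} {n : ℕ}

/-- `[→ Y⟩_def`: the classes of deflations. -/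
def deflationClasses (s : Correspondence E n) (Y : C) : Set (RightClasses Y) :=
  {c | ∃ (W : C) (f : W ⟶ Y), s.IsDeflation f ∧ rightClass f = c}

/-- `ᵀ[→ Y⟩`: the classes of right `T`-determined morphisms. -/
def determinedClasses (T Y : C) : Set (RightClasses Y) :=
  {c | ∃ (W : C) (f : W ⟶ Y), IsRightDetermined T f ∧ rightClass f = c}

/-- `ᵀ[→ Y⟩_def = [→ Y⟩_def ∩ ᵀ[→ Y⟩`. -/
def determinedDeflationClasses (s : Correspondence E n) (T Y : C) : Set (RightClasses Y) :=
  deflationClasses s Y ∩ determinedClasses T Y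

variable [hE : IsBilinear E]

/-- The left `End(X)`-module structure on `𝔼(Y, X)`, `g • δ = g_* δ`. -/
instance (Y X : C) : Module (End X) (Extension E Y X) where
  smul g δ := push E (show X ⟶ X from g) δ
  one_smul δ := push_id E Y X δ
  mul_smul g g' δ := push_comp E (show X ⟶ X from g') (show X ⟶ X from g) δ
  smul_zero g := map_zero (push E (show X ⟶ X from g))
  smul_add g := map_add (push E (show X ⟶ X from g))
  add_smul g g' δ := congrArg (fun t => t δ)
    (hE.push_add Y (show X ⟶ X from g) (show X ⟶ X from g'))
  zero_smul δ := congrArg (fun t => t δ) (map_zero (pushHom E Y X X))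

/-- The image of `δ^♯_X : 𝒞(A, X) ⟶ 𝔼(Y, X)`, `g ↦ g_* δ`, as an `End(X)`-submodule. -/
def imageSharp {Y A : C} (δ : Extension E Y A) (X : C) :
    Submodule (End X) (Extension E Y X) where
  carrier := Set.range fun g : A ⟶ X => push E g δ
  add_mem' := by
    rintro _ _ ⟨g, rfl⟩ ⟨g', rfl⟩
    exact ⟨g + g', congrArg (fun t => t δ) (hE.push_add Y g g')⟩
  zero_mem' := ⟨0, congrArg (fun t => t δ) (map_zero (pushHom E Y A X))⟩
  smul_mem' := by
    rintro c _ ⟨g, rfl⟩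
    exact ⟨g ≫ (show X ⟶ X from c), push_comp E g (show X ⟶ X from c) δ⟩

variable (E) in
/-- The poset `sub_{End(X)} 𝔼(Y, X)` of finitely generated `End(X)`-submodules. -/
abbrev FGSubmodules (Y X : C) := {N : Submodule (End X) (Extension E Y X) // N.FG}

end

end NExang

end

/-! Write `δ` for the extension of a distinguished `n`-exangle ending in a deflation `f`. Two
exactness statements turn factorization into algebra in `𝔼`. A morphism `g` factors through `f` iff
`g^* δ = 0` (`Correspondence.IsExangleOf.factors_iff`). A deflation `f` factors through another,
with extension `δ'`, iff `δ'` is a pushforward of `δ` (`IsNExangulated.factors_iff_exists_push`).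

Duality enters through one pairing. Composing a fixed form on `𝔼(τ⁻ X, X)` with pullbacks gives
every functional on `𝔼(L, X)`, and with pushforwards every functional on `𝔼(τ⁻ X, A)`. As
functionals separate points, an element of `𝔼(L, A)` is killed by all pullbacks along `τ⁻ X ⟶ L` iff
it is killed by all pushforwards along `A ⟶ X` (`ARSDuality.forall_pull_eq_zero_iff`). Applied to
`g^* δ`, this says that `f` is right `τ⁻ X`-determined iff `g^* δ = 0` whenever `g^*` kills the
image of `δ^♯_X`. So the image determines which morphisms factor through `f`, hence the class of
`f`, and larger images give smaller classes (`ARSDuality.imageSharp_le_iff`).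

For surjectivity, generators of a submodule are assembled into a single extension of `Y` by a power
of `X`, whose realization ends in the required deflation (`ARSDuality.exists_imageSharp_eq`). -/

namespace NExang

attribute [local instance] hasBinaryBiproducts_of_finite_biproducts

/-! ### Bilinearity of `𝔼` and finite generation of submodules -/

section Bilinear

variable {k : Type u} [CommRing k] {C : Type u₁} [Category.{v} C] [Preadditive C] [Linear k C]
  (E : Cᵒᵖ ⥤ C ⥤ ModuleCat.{w} k) [hE : IsBilinear E]

lemma push_add_apply {B A A' : C} (a a' : A ⟶ A') (δ : Extension E B A) :
    push E (a + a') δ = push E a δ + push E a' δ :=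
  congrArg (fun t => t δ) (hE.push_add B a a')

lemma push_zero_apply {B A A' : C} (δ : Extension E B A) :
    push E (0 : A ⟶ A') δ = 0 :=
  congrArg (fun t => t δ) (map_zero (pushHom E B A A'))

lemma push_smul_id {B A : C} (r : k) (δ : Extension E B A) :
    push E (r • 𝟙 A) δ = r • δ := by
  have := congrArg (fun t => t δ) (hE.push_smul B r (𝟙 A))
  simpa using this

lemma mem_imageSharp {Y A X : C} {δ : Extension E Y A} {ε : Extension E Y X} :
    ε ∈ imageSharp δ X ↔ ∃ a : A ⟶ X, push E a δ = ε := Iff.rfl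

/-- Over a noetherian base, all `End(X)`-submodules of an extension module that is finite over the
base are finitely generated. -/
lemma submodule_fg_of_finite [IsNoetherianRing k] {Y X : C} [Module.Finite k (Extension E Y X)]
    (N : Submodule (End X) (Extension E Y X)) : N.FG := by
  -- The ring `k` acts through the endomorphisms `r • 𝟙 X`, so `N` is a `k`-submodule and any finite
  -- set of `k`-generators also generates it over `End X`.
  let N' : Submodule k (Extension E Y X) :=
    { carrier := N
      add_mem' := N.add_mem
      zero_mem' := N.zero_mem
      smul_mem' := fun r δ hδ => by
        have : push E (r • 𝟙 X) δ ∈ N := N.smul_mem (show End X from r • 𝟙 X) hδ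
        rwa [push_smul_id] at this }
  obtain ⟨S, hS⟩ := (IsNoetherian.noetherian N' : N'.FG)
  have hN (x : Extension E Y X) : x ∈ N ↔ x ∈ Submodule.span k (S : Set (Extension E Y X)) := by
    rw [hS]; rfl
  refine ⟨S, le_antisymm (Submodule.span_le.2 fun x hx => ?_) fun x hx => ?_⟩
  · exact (hN x).2 (Submodule.subset_span hx)
  · rw [hN] at hx
    induction hx using Submodule.span_induction with
    | mem x hx => exact Submodule.subset_span hx
    | zero => exact zero_mem _
    | add x y _ _ h₁ h₂ => exact add_mem h₁ h₂
    | smul r x _ h =>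
      rw [← push_smul_id]
      exact Submodule.smul_mem _ (show End X from r • 𝟙 X) h

end Bilinear

/-! ### Factorization through deflations and pushforwards of extensions -/

section Exangles

variable {k : Type u} [CommRing k] {C : Type u₁} [Category.{v} C] [Preadditive C]
  {n : ℕ} {E : Cᵒᵖ ⥤ C ⥤ ModuleCat.{w} k} {s : Correspondence E n}

lemma Correspondence.exists_realizes (s : Correspondence E n) {A B : C} (δ : Extension E B A) :
    ∃ X : EndedComplex C n A B, s.Realizes X δ :=
  ⟨_, (Quotient.out_eq (s δ)).symm⟩

variable [HasFiniteBiproducts C] [NeZero n]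

/-- A morphism to `B` factors through a deflation `f` exactly when it kills the extension of a
distinguished `n`-exangle ending in `f`. -/
lemma Correspondence.IsExangleOf.factors_iff (hs : s.IsExactRealization) {A B W : C} {f : W ⟶ B}
    {Z : EndedComplex C n A B} {e : Z.K.X n ≅ W} {δ : Extension E B A}
    (h : s.IsExangleOf f Z e δ) {L : C} (g : L ⟶ B) :
    (∃ t : L ⟶ W, t ≫ f = g) ↔ pull E g δ = 0 := by
  rw [(hs.isNExangle δ Z h.1).contra_last L g]
  constructor
  · rintro ⟨t, rfl⟩
    exact ⟨t ≫ e.inv, by simp [← h.2]⟩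
  · rintro ⟨t, rfl⟩
    exact ⟨t ≫ e.hom, by simp [← h.2]⟩

variable [Linear k C] [hE : IsBilinear E]

/-- Exactness of `𝒞(A, A') ⟶ 𝔼(B, A') ⟶ 𝔼(X_n, A')` for a distinguished `n`-exangle. -/
lemma IsNExangulated.exists_push_eq (hs : IsNExangulated E s) {A A' B : C}
    {X : EndedComplex C n A B} {δ : Extension E B A} (hX : s.Realizes X δ)
    (δ' : Extension E B A') (h : pull E X.dLast δ' = 0) : ∃ a : A ⟶ A', push E a δ = δ' := by
  -- The extension with components `δ` and `δ'`. A good lift of `biprod.fst` from its realization to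
  -- `X` has a cocone realizing `X.dLast^* ρ`, which vanishes.
  let ρ : Extension E B (A ⊞ A') := push E biprod.inl δ + push E biprod.inr δ'
  have hfst : push E biprod.fst ρ = δ := by
    simp [ρ, ← push_comp, push_zero_apply]
  have hsnd : push E biprod.snd ρ = δ' := by
    simp [ρ, ← push_comp, push_zero_apply]
  obtain ⟨W, hW⟩ := s.exists_realizes ρ
  obtain ⟨f, hf, N, ⟨cN⟩, hN⟩ := hs.good_lift_op ρ biprod.fst W X hW (by rwa [hfst])
  have hzero : pull E X.dLast ρ = 0 := by
    have hδ := (hs.isExactRealization.isNExangle δ X hX).pull_eq_zero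
    simp [ρ, ← push_pull, hδ, h]
  rw [hzero] at hN
  have hn : 1 ≤ n := Nat.one_le_iff_ne_zero.2 (NeZero.ne n)
  -- As `N` realizes `0`, every morphism out of `A ⊞ A'` extends along the first map of `N`; this is
  -- used for `biprod.snd`.
  obtain ⟨r, hr⟩ := ((hs.isExactRealization.isNExangle 0 N hN).co_first A'
    (biprod.snd : A ⊞ A' ⟶ A')).1 (map_zero _)
  dsimp only at hr
  let r' := (cN.iso 0 1 rfl hn).inv ≫ r
  have hr' : biprod.lift W.dFirst (W.left.inv ≫ f.f 0) ≫ r' = biprod.snd := by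
    rw [← cN.d_first hn, ← hr]
    simp [r']
  have hf₀ : W.left.inv ≫ f.f 0 = biprod.fst ≫ X.left.inv := by
    rw [Iso.inv_comp_eq, ← Category.assoc, Iso.eq_comp_inv]
    exact hf.1
  -- Pushing `ρ` along this identity kills the first summand, since `W` realizes `ρ`, and leaves
  -- `δ'` as a pushforward of `δ`.
  have hdecomp : W.dFirst ≫ biprod.inl ≫ r' + biprod.fst ≫ X.left.inv ≫ biprod.inr ≫ r' =
      (biprod.snd : A ⊞ A' ⟶ A') := by
    rw [← hr', hf₀, biprod.lift_eq]
    simp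
  refine ⟨X.left.inv ≫ biprod.inr ≫ r', ?_⟩
  rw [← hsnd, ← hdecomp, push_add_apply, push_comp E W.dFirst,
    (hs.isExactRealization.isNExangle ρ W hW).push_eq_zero, map_zero, zero_add,
    push_comp E biprod.fst, hfst]

/-- A deflation `f` factors through a deflation `f'` exactly when the extension of `f'` is a
pushforward of the extension of `f`. -/
lemma IsNExangulated.factors_iff_exists_push (hs : IsNExangulated E s) {A A' B W W' : C}
    {f : W ⟶ B} {f' : W' ⟶ B} {Z : EndedComplex C n A B} {Z' : EndedComplex C n A' B}
    {e : Z.K.X n ≅ W} {e' : Z'.K.X n ≅ W'} {δ : Extension E B A} {δ' : Extension E B A'}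
    (h : s.IsExangleOf f Z e δ) (h' : s.IsExangleOf f' Z' e' δ') :
    (∃ t : W ⟶ W', t ≫ f' = f) ↔ ∃ a : A ⟶ A', push E a δ = δ' := by
  rw [h'.factors_iff hs.isExactRealization]
  constructor
  · intro hf
    refine hs.exists_push_eq h.1 δ' ?_
    have : Z.dLast = e.hom ≫ f := by simp [← h.2]
    rw [this, pull_comp, hf, map_zero]
  · rintro ⟨a, rfl⟩
    rw [← push_pull, (h.factors_iff hs.isExactRealization f).1 ⟨𝟙 W, by simp⟩, map_zero]

end Exangles

/-! ### Auslander-Reiten-Serre duality as a pairing, and determinacy -/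

section Duality

/-- The cogenerator property only tests modules in the universe of `k`; a finite `k`-module has a
copy there. -/
lemma IsInjectiveCogenerator.exists_ne_zero {k : Type u} [CommRing k] {I : Type u}
    [AddCommGroup I] [Module k I] (hI : IsInjectiveCogenerator k I) {M : Type w}
    [AddCommGroup M] [Module k M] [Module.Finite k M] {m : M} (hm : m ≠ 0) :
    ∃ φ : M →ₗ[k] I, φ m ≠ 0 := by
  have : Small.{u} M := Module.Finite.small.{u} k M
  let e : Shrink.{u} M ≃ₗ[k] M := Shrink.linearEquiv k M
  obtain ⟨φ, hφ⟩ := hI.cogenerator _ (e.symm m) (by simpa using hm)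
  exact ⟨φ ∘ₗ e.symm.toLinearMap, hφ⟩

variable {k : Type u} [CommRing k] {C : Type u₁} [Category.{v} C] [Preadditive C] [Linear k C]
  {n : ℕ} {E : Cᵒᵖ ⥤ C ⥤ ModuleCat.{w} k} [hE : IsBilinear E]
  {I : Type u} [AddCommGroup I] [Module k I] (T : ARSDuality E I)

/-- The isomorphism `X ≅ τ τ⁻ X` in the costable category. -/
def ARSDuality.isoTauTauInv (X : C) :
    (toCostable E).obj X ≅ T.τ.functor.obj ((toStable E).obj (T.tauInv X)) :=
  (T.τ.counitIso.app ((toCostable E).obj X)).symm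

/-- The form on `𝔼(τ⁻ X, X)` corresponding to the isomorphism `X ≅ τ τ⁻ X`. -/
def ARSDuality.traceForm (X : C) : Extension E (T.tauInv X) X →ₗ[k] I :=
  (T.Φ (T.tauInv X) X).symm (T.isoTauTauInv X).hom

lemma ARSDuality.Φ_traceForm (X : C) :
    T.Φ (T.tauInv X) X (T.traceForm X) = (T.isoTauTauInv X).hom :=
  (T.Φ (T.tauInv X) X).apply_symm_apply _

/-- A Yoneda argument: the trace form corresponds to an isomorphism, so a functional corresponds to
a costable morphism `A ⟶ X`, which lifts to `C`. -/
lemma ARSDuality.exists_eq_traceForm_comp_push (X : C) {A : C}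
    (φ : Extension E (T.tauInv X) A →ₗ[k] I) :
    ∃ a : A ⟶ X, φ = T.traceForm X ∘ₗ push E a := by
  obtain ⟨a, ha⟩ := (toCostable E).map_surjective (T.Φ _ A φ ≫ (T.isoTauTauInv X).inv)
  refine ⟨a, (T.Φ _ A).injective ?_⟩
  rw [T.natural_right, T.Φ_traceForm, ha, Category.assoc, Iso.inv_hom_id, Category.comp_id]

/-- The same argument in the other variable; fullness of `τ` moves the morphism to the stable
category before it is lifted to `C`. -/
lemma ARSDuality.exists_eq_traceForm_comp_pull (X : C) {L : C}
    (φ : Extension E L X →ₗ[k] I) :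
    ∃ t : T.tauInv X ⟶ L, φ = T.traceForm X ∘ₗ pull E t := by
  obtain ⟨t', ht'⟩ := T.τ.functor.map_surjective ((T.isoTauTauInv X).inv ≫ T.Φ L X φ)
  obtain ⟨t, rfl⟩ := (toStable E).map_surjective t'
  refine ⟨t, (T.Φ L X).injective ?_⟩
  rw [T.natural_left, T.Φ_traceForm, ht', Iso.hom_inv_id_assoc]

/-- An extension is killed by all pullbacks along morphisms from `τ⁻ X` exactly when it is killed by
all pushforwards along morphisms to `X`. -/
lemma ARSDuality.forall_pull_eq_zero_iff (hI : IsInjectiveCogenerator k I) (hfin : IsExtFinite E)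
    (X : C) {L A : C} (ε : Extension E L A) :
    (∀ t : T.tauInv X ⟶ L, pull E t ε = 0) ↔ ∀ a : A ⟶ X, push E a ε = 0 := by
  constructor
  · intro h a
    by_contra hne
    have := hfin L X
    obtain ⟨φ, hφ⟩ := hI.exists_ne_zero hne
    obtain ⟨t, rfl⟩ := T.exists_eq_traceForm_comp_pull X φ
    exact hφ (by simp [← push_pull, h t])
  · intro h t
    by_contra hne
    have := hfin (T.tauInv X) A
    obtain ⟨φ, hφ⟩ := hI.exists_ne_zero hne
    obtain ⟨a, rfl⟩ := T.exists_eq_traceForm_comp_push X φ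
    exact hφ (by simp [push_pull, h a])

variable [HasFiniteBiproducts C] [NeZero n] {s : Correspondence E n}

/-- A deflation with extension `δ` is right `τ⁻ X`-determined exactly when vanishing of the pullbacks
of `δ` is detected on its pushforwards to `X`. -/
lemma ARSDuality.isRightDetermined_iff (hI : IsInjectiveCogenerator k I) (hfin : IsExtFinite E)
    (hs : s.IsExactRealization) (X : C) {A B W : C} {f : W ⟶ B}
    {Z : EndedComplex C n A B} {e : Z.K.X n ≅ W} {δ : Extension E B A}
    (h : s.IsExangleOf f Z e δ) :
    IsRightDetermined (T.tauInv X) f ↔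
      ∀ (L : C) (g : L ⟶ B), (∀ a : A ⟶ X, pull E g (push E a δ) = 0) → pull E g δ = 0 := by
  refine forall_congr' fun L => forall_congr' fun g => ?_
  -- The exchange of pullbacks and pushforwards is applied to `pull E g δ`.
  simp only [h.factors_iff hs, pull_comp, T.forall_pull_eq_zero_iff hI hfin X, push_pull]

end Duality

/-! ### Right equivalence -/

section RightClasses

variable {D : Type u₁} [Category.{v} D]

lemma rightClass_le_iff {W W' Y : D} (f : W ⟶ Y) (f' : W' ⟶ Y) :
    rightClass f ≤ rightClass f' ↔ ∃ t : W ⟶ W', t ≫ f' = f := Iff.rfl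

lemma IsRightDetermined.of_rightClass_eq {T W W' Y : D} {f : W ⟶ Y} {f' : W' ⟶ Y}
    (h : IsRightDetermined T f) (hff' : rightClass f = rightClass f') :
    IsRightDetermined T f' := by
  obtain ⟨t, rfl⟩ := (rightClass_le_iff f f').1 hff'.le
  obtain ⟨t', ht'⟩ := (rightClass_le_iff _ _).1 hff'.ge
  intro L g hg
  obtain ⟨r, hr⟩ := h L g fun q => by
    obtain ⟨p, hp⟩ := hg q
    exact ⟨p ≫ t', by rw [Category.assoc, ht', hp]⟩
  exact ⟨r ≫ t, by rw [Category.assoc, hr]⟩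

end RightClasses

/-! ### Comparing images, and realizing submodules -/

section Main

variable {k : Type u} [CommRing k] {C : Type u₁} [Category.{v} C] [Preadditive C]
  {n : ℕ} {E : Cᵒᵖ ⥤ C ⥤ ModuleCat.{w} k}
  {s : Correspondence E n}

/-- The poset is an intersection, so the deflation and the determined morphism in a class may
differ. Determinacy is invariant under right equivalence, so the deflation has both properties. -/
lemma determinedDeflationClasses.exists_isExangleOf {T Y : C}
    (c : determinedDeflationClasses s T Y) :
    ∃ (W : C) (f : W ⟶ Y) (A : C) (δ : Extension E Y A) (Z : EndedComplex C n A Y)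
      (e : Z.K.X n ≅ W), s.IsExangleOf f Z e δ ∧ IsRightDetermined T f ∧ rightClass f = c.1 := by
  obtain ⟨c, ⟨W, f, ⟨A, δ, Z, e, h⟩, rfl⟩, W', f', hf', hc⟩ := c
  exact ⟨W, f, A, δ, Z, e, h, hf'.of_rightClass_eq hc, rfl⟩

variable [HasFiniteBiproducts C] [NeZero n] [Linear k C] [hE : IsBilinear E]
  {I : Type u} [AddCommGroup I] [Module k I]

/-- Since `f^* δ = 0`, `f^*` kills the image of `δ`, hence the smaller image of `δ'`, and
determinacy of `f'` gives `f^* δ' = 0`. The converse needs no determinacy, as `δ'` is then a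
pushforward of `δ`. -/
lemma ARSDuality.imageSharp_le_iff (T : ARSDuality E I) (hI : IsInjectiveCogenerator k I)
    (hfin : IsExtFinite E) (hs : IsNExangulated E s) (X : C) {A A' B W W' : C}
    {f : W ⟶ B} {f' : W' ⟶ B} {Z : EndedComplex C n A B} {Z' : EndedComplex C n A' B}
    {e : Z.K.X n ≅ W} {e' : Z'.K.X n ≅ W'} {δ : Extension E B A} {δ' : Extension E B A'}
    (h : s.IsExangleOf f Z e δ) (h' : s.IsExangleOf f' Z' e' δ')
    (hf' : IsRightDetermined (T.tauInv X) f') :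
    imageSharp δ' X ≤ imageSharp δ X ↔ rightClass f ≤ rightClass f' := by
  rw [rightClass_le_iff]
  constructor
  · intro hle
    rw [h'.factors_iff hs.isExactRealization]
    refine (T.isRightDetermined_iff hI hfin hs.isExactRealization X h').1 hf' _ f fun a' => ?_
    obtain ⟨a, ha⟩ := (mem_imageSharp E).1 (hle ((mem_imageSharp E).2 ⟨a', rfl⟩))
    rw [← ha, ← push_pull, (h.factors_iff hs.isExactRealization f).1 ⟨𝟙 W, by simp⟩, map_zero]
  · rw [hs.factors_iff_exists_push h h']
    rintro ⟨a, rfl⟩ _ ⟨b, rfl⟩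
    exact ⟨a ≫ b, push_comp E a b δ⟩

/-- A finitely generated submodule of `𝔼(Y, X)` is the image attached to a deflation which is right
`τ⁻ X`-determined. -/
lemma ARSDuality.exists_imageSharp_eq (T : ARSDuality E I) (hI : IsInjectiveCogenerator k I)
    (hfin : IsExtFinite E) (hs : IsNExangulated E s) (X Y : C)
    (N : Submodule (End X) (Extension E Y X)) (hN : N.FG) :
    ∃ (W : C) (f : W ⟶ Y) (A : C) (δ : Extension E Y A) (Z : EndedComplex C n A Y)
      (e : Z.K.X n ≅ W), s.IsExangleOf f Z e δ ∧ IsRightDetermined (T.tauInv X) f ∧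
        imageSharp δ X = N := by
  obtain ⟨m, γ, rfl⟩ := Submodule.fg_iff_exists_fin_generating_family.1 hN
  let P : Fin m → C := fun _ => X
  -- The extension of `Y` by `X^m` whose components are the generators `γ i`.
  let ρ : Extension E Y (⨁ P) := ∑ i, push E (biproduct.ι P i) (γ i)
  have hπ : ∀ i, push E (biproduct.π P i) ρ = γ i := by
    intro i
    simp only [ρ, map_sum]
    rw [Finset.sum_eq_single i]
    · rw [← push_comp, biproduct.ι_π_self]
      exact push_id E Y X _
    · intro j _ hj
      rw [← push_comp, biproduct.ι_π_ne _ hj, push_zero_apply]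
    · simp
  have hpush : ∀ {A : C} (a : ⨁ P ⟶ A),
      push E a ρ = ∑ i, push E (biproduct.ι P i ≫ a) (γ i) := by
    intro A a
    simp only [ρ, map_sum, push_comp]
  obtain ⟨Z, hZ⟩ := s.exists_realizes ρ
  have hex : s.IsExangleOf Z.dLast Z (Iso.refl _) ρ := ⟨hZ, by simp⟩
  refine ⟨_, Z.dLast, _, ρ, Z, Iso.refl _, hex, ?_, le_antisymm ?_ ?_⟩
  -- The components of `ρ` are themselves pushforwards to `X`, so a pullback killing all such
  -- pushforwards kills `ρ`.
  · refine (T.isRightDetermined_iff hI hfin hs.isExactRealization X hex).2 fun L g hg => ?_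
    simp only [ρ, map_sum]
    refine Finset.sum_eq_zero fun i _ => ?_
    rw [← push_pull, ← hπ i, hg, map_zero]
  · rintro _ ⟨a, rfl⟩
    dsimp only
    rw [hpush]
    exact sum_mem fun i _ => Submodule.smul_mem _ (show End X from biproduct.ι P i ≫ a)
      (Submodule.subset_span ⟨i, rfl⟩)
  · rw [Submodule.span_le]
    rintro _ ⟨i, rfl⟩
    exact ⟨biproduct.π P i, hπ i⟩

end Main

end NExang

/-! ### The anti-isomorphism -/

theorem theorem4p11 {k : Type u} [CommRing k] [IsArtinianRing k]
    {C : Type u₁} [Category.{v} C] [Preadditive C] [HasFiniteBiproducts C] [Linear k C]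
    (n : ℕ) [NeZero n] (E : Cᵒᵖ ⥤ C ⥤ ModuleCat.{w} k) [NExang.IsBilinear E]
    (s : NExang.Correspondence E n) (hs : NExang.IsNExangulated E s)
    (hKS : NExang.IsKrullSchmidt C) (hfin : NExang.IsExtFinite E) (hWIC : s.WIC)
    (I : Type u) [AddCommGroup I] [Module k I] (hI : NExang.IsMinimalInjectiveCogenerator k I)
    (T : NExang.ARSDuality E I) (X Y : C) :
    ∃ ξ : NExang.determinedDeflationClasses s (T.tauInv X) Y ≃o (NExang.FGSubmodules E Y X)ᵒᵈ,
      ∀ (W : C) (f : W ⟶ Y)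
        (hf : NExang.rightClass f ∈ NExang.determinedDeflationClasses s (T.tauInv X) Y)
        (A : C) (δ : NExang.Extension E Y A) (Z : NExang.EndedComplex C n A Y)
        (e : Z.K.X n ≅ W), s.IsExangleOf f Z e δ →
          (OrderDual.ofDual (ξ ⟨NExang.rightClass f, hf⟩)).1 = NExang.imageSharp δ X := by
  have hI' := hI.toIsInjectiveCogenerator
  choose W f A δ Z e hex hdet hcl using
    NExang.determinedDeflationClasses.exists_isExangleOf (s := s) (T := T.tauInv X) (Y := Y)
  have hFG (N : Submodule (End X) (NExang.Extension E Y X)) : N.FG :=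
    have := hfin Y X
    NExang.submodule_fg_of_finite E N
  let φ (c : NExang.determinedDeflationClasses s (T.tauInv X) Y) :
      (NExang.FGSubmodules E Y X)ᵒᵈ :=
    OrderDual.toDual ⟨NExang.imageSharp (δ c) X, hFG _⟩
  have hle : ∀ c c', φ c ≤ φ c' ↔ c ≤ c' := by
    intro c c'
    rw [← Subtype.coe_le_coe (x := c), ← hcl c, ← hcl c']
    exact T.imageSharp_le_iff hI' hfin hs X (hex c) (hex c') (hdet c')
  -- Independence of the chosen representative and exangle: the comparison of images applies in both
  -- directions to right equivalent deflations.
  have hφ : ∀ (V : C) (g : V ⟶ Y)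
      (hg : NExang.rightClass g ∈ NExang.determinedDeflationClasses s (T.tauInv X) Y)
      (B : C) (γ : NExang.Extension E Y B) (Z' : NExang.EndedComplex C n B Y)
      (e' : Z'.K.X n ≅ V), s.IsExangleOf g Z' e' γ →
        NExang.imageSharp (δ ⟨_, hg⟩) X = NExang.imageSharp γ X := by
    intro V g hg B γ Z' e' h
    have hgdet := (hdet ⟨_, hg⟩).of_rightClass_eq (hcl ⟨_, hg⟩)
    exact le_antisymm
      ((T.imageSharp_le_iff hI' hfin hs X h (hex _) (hdet _)).2 (hcl ⟨_, hg⟩).ge)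
      ((T.imageSharp_le_iff hI' hfin hs X (hex _) h hgdet).2 (hcl ⟨_, hg⟩).le)
  let ι : NExang.determinedDeflationClasses s (T.tauInv X) Y ↪o (NExang.FGSubmodules E Y X)ᵒᵈ :=
    OrderEmbedding.ofMapLEIff φ hle
  have hsurj : Function.Surjective ι := by
    intro N
    obtain ⟨V, g, B, γ, Z', e', h, hg, hN⟩ := T.exists_imageSharp_eq hI' hfin hs X Y
      (OrderDual.ofDual N).1 (OrderDual.ofDual N).2
    have hmem : NExang.rightClass g ∈ NExang.determinedDeflationClasses s (T.tauInv X) Y :=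
      ⟨⟨V, g, ⟨B, γ, Z', e', h⟩, rfl⟩, V, g, hg, rfl⟩
    exact ⟨⟨_, hmem⟩, Subtype.ext ((hφ V g hmem B γ Z' e' h).trans hN)⟩
  exact ⟨RelIso.ofSurjective ι hsurj, hφ⟩
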